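/- For a partial order $X$, let $X^*$ be the set of finite sequences with members in $X$, with Higman's order: $s\le t$ if and only if there is a strictly increasing map $f:\{0,\dots,|s|-1\}\to\{0,\dots,|t|-1\}$ with $s_i\le t_{f(i)}$ for all $i<|s|$. For a well order $\alpha$, let $\mathsf S^{\mathsf w}_\alpha$ be the set of finite sequences with members in $\alpha$, ordered by the weak gap condition: $s\le_{\mathsf w}t$ if and only if there is a strictly increasing map $f:\{0,\dots,|s|-1\}\to\{0,\dots,|t|-1\}$ such that (i) $s_i\le t_{f(i)}$ for all $i<|s|$, and (ii) $s_{i+1}\le t_j$ for all $i$ with $i+1<|s|$ and all $j$ with $f(i)<j<f(i+1)$. A map $f:X\to Y$ between partial orders is called a quasi-embedding if $f(x)\le f(x')$ implies $x\le x'$ for all $x,x'\in X$. Then there is no quasi-embedding $f:\omega^*\to\mathsf S^{\mathsf w}_2$, where $\omega=\mathbb N$ and $2=\{0<1\}$ carry their usual orders. -/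

import Mathlib

/-- Higman's embeddability relation on the set `X^*` of finite sequences over an ordered set `X`:
`s ≤ t` iff there is a strictly increasing `f : |s| → |t|` with `s_i ≤ t_{f(i)}` for all `i < |s|`.
-/
def HigmanLE {X : Type*} [PartialOrder X] (s t : List X) : Prop :=
  ∃ f : Fin s.length → Fin t.length, StrictMono f ∧ ∀ i, s.get i ≤ t.get (f i)

/-- The weak gap order `≤_w` on the set of finite sequences over a well order `α`:
`s ≤_w t` iff there is a strictly increasing `f : |s| → |t|` such that
* `s_i ≤ t_{f(i)}` for all `i < |s|`, and
* `s_{i+1} ≤ t_j` for all `i < |s| - 1` and all `j` with `f(i) < j < f(i+1)`. -/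
def WeakGapLE {α : Type*} [LinearOrder α] [WellFoundedLT α] (s t : List α) : Prop :=
  ∃ f : Fin s.length → Fin t.length, StrictMono f ∧
    (∀ i, s.get i ≤ t.get (f i)) ∧
    ∀ (i : ℕ) (hi : i + 1 < s.length) (j : Fin t.length),
      f ⟨i, Nat.lt_of_succ_lt hi⟩ < j → j < f ⟨i + 1, hi⟩ → s.get ⟨i + 1, hi⟩ ≤ t.get j

/-- A map `f` from `X`, ordered by `rX`, to `Y`, ordered by `rY`, is a quasi-embedding if it
reflects the order. -/
def IsQuasiEmbedding {X Y : Type*} (rX : X → X → Prop) (rY : Y → Y → Prop) (f : X → Y) : Prop :=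
  ∀ x x' : X, rY (f x) (f x') → rX x x'

/-! The obstruction is ordinal-theoretic. Read a 0/1 word as the sequence of lengths of its blocks
of ones; embedding block sequences embeds the words in the weak gap order
(`EmbLE.weakGapLE_blocks`). Suppose `f` is a quasi-embedding and `n` is the length of `f [0, 0]`. A
block longer than `n` in `f [n + 3]` would put `f [0, 0]` below it, so all its blocks are at most
`n`; let `N` be their number. If `s` has entries at most `n + 2`, then `f s` has fewer than `N`
blocks of length at least `n`, else `f [n + 3] ≤ f s`. Cutting at these `m < N` long blocks leaves
`m + 1` sequences with entries below `n`, and `m` numbers.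

Such data form a finite union of products whose order type is below `ω ^ ω ^ (n + 2)`
(`not_reflecting`, by passing to residuals, `exists_residual`). But the sequences with entries at
most `n + 2` reflect all ordinals below `ω ^ ω ^ (n + 2)` (`exists_reflecting`). -/

/-! ### Natural sums through Cantor normal forms -/

open Ordinal in
theorem cnf_eval_split (b z : Ordinal) (f : Ordinal →₀ Ordinal) :
    CNF.eval b f = CNF.eval b (f.filter (z < ·)) +
      (b ^ z * f z + CNF.eval b (f.filter (· < z))) := by
  have key : f = f.filter (z < ·) + (Finsupp.single z (f z) + f.filter (· < z)) := by
    ext x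
    rcases lt_trichotomy x z with h | rfl | h
    · simp [h, h.not_gt, h.ne']
    · simp
    · simp [h, h.not_gt, h.ne]
  have low : ∀ e ∈ (f.filter (· < z)).support, e < z := by
    intro e he
    simp only [Finsupp.support_filter, Finset.mem_filter] at he
    exact he.2
  conv_lhs => rw [key]
  rw [CNF.eval_add, CNF.eval_single_add' _ low]
  intro e₁ h₁ e₂ h₂
  simp only [Finsupp.support_filter, Finset.mem_filter] at h₁
  rcases Finset.mem_union.1 (Finsupp.support_add h₂) with h | h
  · have := Finsupp.support_single_subset h
    rw [Finset.mem_singleton] at this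
    exact this ▸ h₁.2.le
  · exact ((low _ h).trans h₁.2).le

open Ordinal in
/-- The natural (Hessenberg) sum of the powers `ω ^ x` for `x ∈ M`. -/
noncomputable def hsum (M : Multiset Ordinal.{0}) : Ordinal.{0} :=
  CNF.eval ω (M.toFinsupp.mapRange (Nat.cast : ℕ → Ordinal) Nat.cast_zero)

open Ordinal in
theorem hsum_lt_opow {M : Multiset Ordinal} {z : Ordinal} (h : ∀ x ∈ M, x < z) :
    hsum M < ω ^ z := by
  apply CNF.eval_lt
  · intro e
    simp [natCast_lt_omega0]
  · intro e he
    apply h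
    by_contra hne
    simp [Multiset.count_eq_zero_of_notMem hne] at he

-- The coefficients above `z` agree, the one at `z` drops by one, and all lower terms together stay
-- below `ω ^ z`.
open Ordinal in
theorem hsum_add_lt_hsum_cons {M S : Multiset Ordinal} {z : Ordinal} (h : ∀ x ∈ S, x < z) :
    hsum (M + S) < hsum (z ::ₘ M) := by
  unfold hsum
  rw [cnf_eval_split ω z, cnf_eval_split ω z (Finsupp.mapRange _ _ (Multiset.toFinsupp (z ::ₘ M)))]
  have e : (Finsupp.mapRange (Nat.cast : ℕ → Ordinal) Nat.cast_zero
      (Multiset.toFinsupp (M + S))).filter (z < ·) =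
      (Finsupp.mapRange (Nat.cast : ℕ → Ordinal) Nat.cast_zero
      (Multiset.toFinsupp (z ::ₘ M))).filter (z < ·) := by
    ext x
    by_cases hx : z < x
    · have : x ∉ S := fun hs => hx.not_gt (h x hs)
      simp [hx, Multiset.count_cons_of_ne hx.ne', Multiset.count_eq_zero_of_notMem this]
    · simp [hx]
  rw [e, add_lt_add_iff_left]
  have hz : z ∉ S := fun hs => (h z hs).false
  have low : CNF.eval ω ((Finsupp.mapRange (Nat.cast : ℕ → Ordinal) Nat.cast_zero
      (Multiset.toFinsupp (M + S))).filter (· < z)) < ω ^ z := by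
    apply CNF.eval_lt
    · intro x
      by_cases hx : x < z
      · simp only [Finsupp.filter_apply, hx, if_true, Finsupp.mapRange_apply]
        exact natCast_lt_omega0 _
      · simp [hx, omega0_pos]
    · intro x hx
      simp only [Finsupp.support_filter, Finset.mem_filter] at hx
      exact hx.2
  refine lt_of_lt_of_le (add_lt_add_right low _) (le_trans ?_ (le_add_right le_rfl))
  simp [Multiset.count_eq_zero_of_notMem hz, mul_add]

/-! ### Embeddings of sequences and cutting at large letters -/

/-- Pointwise embeddability of finite sequences of natural numbers, in inductive form. -/
abbrev EmbLE : List ℕ → List ℕ → Prop := List.SublistForall₂ (· ≤ ·)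

theorem EmbLE.length_le {u v : List ℕ} (h : EmbLE u v) : u.length ≤ v.length := by
  induction h with
  | nil => simp
  | cons _ _ ih => simpa using ih
  | cons_right _ ih => simp; omega

theorem EmbLE.append {u u' v v' : List ℕ} (h : EmbLE u u') (h' : EmbLE v v') :
    EmbLE (u ++ v) (u' ++ v') := by
  induction h with
  | @nil l =>
    induction l with
    | nil => exact h'
    | cons a l ih => exact .cons_right ih
  | cons hr _ ih => exact .cons hr ih
  | cons_right _ ih => exact .cons_right ih

theorem EmbLE.of_length_le_filter {k : ℕ} {t w : List ℕ} (ht : ∀ x ∈ t, x ≤ k)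
    (h : t.length ≤ (w.filter (k ≤ ·)).length) : EmbLE t w := by
  induction w generalizing t with
  | nil =>
    obtain rfl : t = [] := by simpa using h
    exact .nil
  | cons a w ih =>
    cases t with
    | nil => exact .nil
    | cons x t =>
      by_cases ha : k ≤ a
      · refine .cons ((ht x (by simp)).trans ha) (ih (fun y hy => ht y (by simp [hy])) ?_)
        simpa [ha] using h
      · refine .cons_right (ih ht ?_)
        simpa [ha] using h

/-- The members of `us`, separated by the letters in `cs`. -/
def glue : List ℕ → List (List ℕ) → List ℕ
  | [], us => us.headD []
  | c :: cs, us => us.headD [] ++ c :: glue cs us.tail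

theorem glue_mono {cs cs' : List ℕ} {us us' : List (List ℕ)} (hc : List.Forall₂ (· ≤ ·) cs cs')
    (hu : List.Forall₂ EmbLE us us') : EmbLE (glue cs us) (glue cs' us') := by
  induction hc generalizing us us' with
  | nil =>
    cases hu with
    | nil => exact .nil
    | cons h _ => exact h
  | cons hc _ ih =>
    cases hu with
    | nil => exact .cons hc (ih .nil)
    | cons h hs => exact h.append (.cons hc (ih hs))

theorem exists_glue (k : ℕ) (w : List ℕ) : ∃ us : List (List ℕ),
    us.length = (w.filter (k ≤ ·)).length + 1 ∧ (∀ u ∈ us, ∀ x ∈ u, x < k) ∧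
      glue (w.filter (k ≤ ·)) us = w := by
  induction w with
  | nil => exact ⟨[[]], by simp [glue]⟩
  | cons a w ih =>
    obtain ⟨us, hl, hs, hg⟩ := ih
    by_cases ha : k ≤ a
    · refine ⟨[] :: us, ?_, ?_, ?_⟩
      · simp [ha, hl]
      · simpa using hs
      · simp [ha, glue, hg]
    · cases us with
      | nil => simp at hl
      | cons u us =>
        refine ⟨(a :: u) :: us, ?_, ?_, ?_⟩
        · simpa [ha] using hl
        · simp only [List.mem_cons, forall_eq_or_imp] at hs ⊢
          exact ⟨⟨not_le.1 ha, hs.1⟩, hs.2⟩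
        · rw [List.filter_cons_of_neg (by simpa using ha)]
          generalize hcs : w.filter (k ≤ ·) = cs at hg
          cases cs <;> simpa [glue] using hg

/-! ### Upper bounds: residuals of products -/

/-- `Fills B e`: the members of `e` are sequences, the `i`-th one with entries below `B i`. -/
abbrev Fills : List ℕ → List (List ℕ) → Prop := List.Forall₂ fun b w => ∀ x ∈ w, x < b

/-- The order of the product of the sets of sequences over the bounds in a list. -/
abbrev ProdLE : List (List ℕ) → List (List ℕ) → Prop := List.Forall₂ EmbLE

/-- An ordinal `γ` such that the product with bounds `B` has maximal order type at most
`ω ^ γ`. -/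
noncomputable def weight (B : List ℕ) : Ordinal.{0} := hsum (B.map (Nat.cast : ℕ → Ordinal))

/-- The first list arises from the second, up to order, by replacing a member by finitely many smaller ones. -/
def Reduces (B' B : List ℕ) : Prop :=
  ∃ (b : ℕ) (M S : Multiset ℕ), (B : Multiset ℕ) = b ::ₘ M ∧ (B' : Multiset ℕ) = M + S ∧
    ∀ x ∈ S, x < b

theorem Reduces.cons {B' B : List ℕ} (h : Reduces B' B) (a : ℕ) :
    Reduces (a :: B') (a :: B) := by
  obtain ⟨b, M, S, h₁, h₂, h₃⟩ := h
  refine ⟨b, a ::ₘ M, S, ?_, ?_, h₃⟩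
  · rw [← Multiset.cons_coe, h₁, Multiset.cons_swap]
  · rw [← Multiset.cons_coe, h₂, Multiset.cons_add]

theorem Reduces.weight_lt {B' B : List ℕ} (h : Reduces B' B) : weight B' < weight B := by
  obtain ⟨b, M, S, h₁, h₂, h₃⟩ := h
  have e (L : List ℕ) : weight L = hsum ((L : Multiset ℕ).map (Nat.cast : ℕ → Ordinal)) := rfl
  rw [e, e, h₁, h₂, Multiset.map_add, Multiset.map_cons]
  apply hsum_add_lt_hsum_cons
  simpa using h₃

theorem fills_replicate {m k : ℕ} {us : List (List ℕ)} (hl : us.length = m)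
    (h : ∀ u ∈ us, ∀ x ∈ u, x < k) : Fills (List.replicate m k) us := by
  subst hl
  induction us with
  | nil => exact .nil
  | cons u us ih =>
    rw [List.length_cons, List.replicate_succ]
    exact .cons (h u (by simp)) (ih fun v hv => h v (by simp [hv]))

/-- The elements of a product that do not lie above a given one are covered by the images of
finitely many products of smaller weight under order preserving maps. -/
theorem exists_residual {B : List ℕ} {e₀ : List (List ℕ)} (h₀ : Fills B e₀) :
    ∃ (κ : Type) (_ : Fintype κ) (sh : κ → List ℕ) (dec : κ → List (List ℕ) → List (List ℕ)),
      (∀ j, Reduces (sh j) B) ∧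
      (∀ j d d', ProdLE d d' → ProdLE (dec j d) (dec j d')) ∧
      ∀ e, Fills B e → ¬ ProdLE e₀ e → ∃ j d, Fills (sh j) d ∧ dec j d = e := by
  induction h₀ with
  | nil =>
    refine ⟨Empty, inferInstance, nofun, nofun, nofun, nofun, fun e he hne => ?_⟩
    cases he
    exact absurd .nil hne
  | @cons b t B e₀ ht h₀ ih =>
    obtain ⟨κ, _, sh, dec, hsh, hdec, hcov⟩ := ih
    refine ⟨Fin t.length ⊕ κ, inferInstance,
      -- Either the first coordinate fails to lie above `t`, so it has some `m < t.length` letters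
      -- `b - 1` separating `m + 1` sequences over smaller letters, or the failure is in the tail.
      Sum.elim (fun m => List.replicate (m + 1) (b - 1) ++ B) (fun j => b :: sh j),
      Sum.elim (fun m d => glue (List.replicate m (b - 1)) (d.take (m + 1)) :: d.drop (m + 1))
        (fun j d => d.headD [] :: dec j d.tail), ?_, ?_, ?_⟩
    · rintro (m | j)
      · refine ⟨b, B, Multiset.replicate (m + 1) (b - 1), rfl, ?_, ?_⟩
        · rw [Sum.elim_inl, ← Multiset.coe_add, Multiset.coe_replicate, add_comm]
        · intro x hx
          rw [Multiset.eq_of_mem_replicate hx]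
          have : b ≠ 0 := by
            rintro rfl
            cases t with
            | nil => exact m.elim0
            | cons a t => simpa using ht a (by simp)
          omega
      · exact (hsh j).cons b
    · rintro (m | j) d d' h
      · exact .cons (glue_mono (List.forall₂_same.2 fun _ _ => le_rfl)
          (List.forall₂_take _ h)) (List.forall₂_drop _ h)
      · cases h with
        | nil => exact .cons .nil (hdec _ _ _ .nil)
        | cons h hs => exact .cons h (hdec _ _ _ hs)
    · intro e he hne
      cases he with
      | @cons _ w _ e hw he =>
      by_cases hle : ProdLE e₀ e
      · have hlt : (w.filter (b - 1 ≤ ·)).length < t.length := by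
          by_contra hge
          exact hne (.cons (.of_length_le_filter (fun x hx => Nat.le_sub_one_of_lt (ht x hx))
            (not_lt.1 hge)) hle)
        obtain ⟨us, hl, hs, hg⟩ := exists_glue (b - 1) w
        have hrep : w.filter (b - 1 ≤ ·) =
            List.replicate (w.filter (b - 1 ≤ ·)).length (b - 1) := by
          rw [List.eq_replicate_iff]
          refine ⟨rfl, fun x hx => ?_⟩
          rw [List.mem_filter, decide_eq_true_iff] at hx
          have := hw x hx.1
          omega
        refine ⟨.inl ⟨_, hlt⟩, us ++ e, ?_, ?_⟩
        · exact List.rel_append (fills_replicate hl hs) he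
        · simp only [Sum.elim_inl]
          rw [← hrep, ← hl, List.take_left, List.drop_left, hg]
      · obtain ⟨j, d, hd, rfl⟩ := hcov e he hle
        exact ⟨.inr j, w :: d, .cons hw hd, rfl⟩

/-- There is no order reflecting map from the ordinals up to the Hessenberg sum of the
maximal order types of finitely many products into their disjoint union. -/
theorem not_reflecting (o : Ordinal.{0}) (ι : Type) [Fintype ι] (sh : ι → List ℕ)
    (ho : hsum (∑ i, {weight (sh i)}) = o) (g : Ordinal.{0} → ι × List (List ℕ))
    (hg : ∀ α ≤ o, Fills (sh (g α).1) (g α).2)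
    (hr : ∀ α ≤ o, ∀ β ≤ o, (g α).1 = (g β).1 → ProdLE (g α).2 (g β).2 → α ≤ β) : False := by
  induction o using WellFoundedLT.induction generalizing ι with
  | ind o IH =>
  classical
  obtain ⟨κ, _, sh', dec, hsh, hdec, hcov⟩ := exists_residual (hg o le_rfl)
  set i₀ := (g o).1
  let D : ({i // i ≠ i₀} ⊕ κ) × List (List ℕ) → ι × List (List ℕ) := fun p =>
    Sum.elim (fun i => (i.1, p.2)) (fun j => (i₀, dec j p.2)) p.1
  let s : {i // i ≠ i₀} ⊕ κ → List ℕ := Sum.elim (fun i => sh i) sh'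
  -- Only the summand containing `g o` changes: it is replaced by its residuals, of smaller weight.
  have hlt : hsum (∑ i, {weight (s i)}) < o := by
    rw [← ho, Fintype.sum_eq_add_sum_subtype_ne (fun i => ({weight (sh i)} : Multiset Ordinal)) i₀,
      Fintype.sum_sum_type, Multiset.singleton_add]
    apply hsum_add_lt_hsum_cons
    intro x hx
    obtain ⟨j, -, hj⟩ := Multiset.mem_sum.1 hx
    rw [Multiset.mem_singleton.1 hj]
    exact (hsh j).weight_lt
  have hex : ∀ α < o, ∃ p, Fills (s p.1) p.2 ∧ D p = g α := by
    intro α hα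
    by_cases hi : (g α).1 = i₀
    · have hne : ¬ ProdLE (g o).2 (g α).2 := fun h =>
        hα.not_ge (hr o le_rfl α hα.le hi.symm h)
      obtain ⟨j, d, hd, he⟩ := hcov _ (hi ▸ hg α hα.le) hne
      exact ⟨(.inr j, d), hd, Prod.ext hi.symm he⟩
    · exact ⟨(.inl ⟨_, hi⟩, (g α).2), hg α hα.le, rfl⟩
  have : Nonempty (({i // i ≠ i₀} ⊕ κ) × List (List ℕ)) :=
    let ⟨p, _⟩ := hex _ hlt
    ⟨p⟩
  choose! g' hg' using hex
  refine IH _ hlt _ s rfl g' (fun α hα => (hg' α (hα.trans_lt hlt)).1) ?_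
  intro α hα β hβ hi hle
  replace hα := hα.trans_lt hlt
  replace hβ := hβ.trans_lt hlt
  have hD : (D (g' α)).1 = (D (g' β)).1 ∧ ProdLE (D (g' α)).2 (D (g' β)).2 := by
    generalize g' α = p at hi hle
    generalize g' β = q at hi hle
    obtain ⟨i, d⟩ := p
    obtain ⟨i', d'⟩ := q
    obtain rfl : i = i' := hi
    cases i with
    | inl i => exact ⟨rfl, hle⟩
    | inr j => exact ⟨rfl, hdec _ _ _ hle⟩
  rw [(hg' α hα).2, (hg' β hβ).2] at hD
  exact hr α hα.le β hβ.le hD.1 hD.2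

/-! ### Lower bounds: reflecting ordinals into sequences -/

theorem EmbLE.length_filter_le {k : ℕ} {s t : List ℕ} (h : EmbLE s t) :
    (s.filter (k ≤ ·)).length ≤ (t.filter (k ≤ ·)).length := by
  induction h with
  | nil => simp
  | @cons a b s t hab _ ih =>
    by_cases ha : k ≤ a
    · simpa [ha, ha.trans hab] using ih
    · by_cases hb : k ≤ b
      · simp only [List.filter_cons, ha, hb, decide_true, decide_false]
        exact ih.trans (by simp)
      · simpa [ha, hb] using ih
  | @cons_right b s t _ ih =>
    refine ih.trans ?_
    by_cases hb : k ≤ b <;> simp [hb]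

/-- The displayed `k` on the left cannot land in `u'`, whose letters are too small, nor in `v'`,
which has too few large letters to receive `k :: v`. So it lands on the displayed `k`. -/
theorem EmbLE.split {k : ℕ} {u u' v v' : List ℕ} (hu' : ∀ x ∈ u', x < k)
    (hv : (v.filter (k ≤ ·)).length = (v'.filter (k ≤ ·)).length)
    (h : EmbLE (u ++ k :: v) (u' ++ k :: v')) : EmbLE u u' ∧ EmbLE v v' := by
  have count (r : List ℕ) (hr : EmbLE (r ++ k :: v) v') : False := by
    have := hr.length_filter_le (k := k)
    simp only [List.filter_append, List.length_append, List.filter_cons, le_refl, decide_true,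
      if_true, List.length_cons] at this
    omega
  induction u' generalizing u with
  | nil =>
    cases u with
    | nil =>
      cases h with
      | cons _ h => exact ⟨.nil, h⟩
      | cons_right h => exact (count [] h).elim
    | cons a u =>
      cases h with
      | cons _ h => exact (count u h).elim
      | cons_right h => exact (count (a :: u) h).elim
  | cons x u' ih =>
    have ih := fun u => @ih u fun y hy => hu' y (by simp [hy])
    cases u with
    | nil =>
      cases h with
      | cons hx _ => exact absurd (hu' x (by simp)) (not_lt.2 hx)
      | cons_right h => exact ⟨.nil, (ih [] h).2⟩
    | cons a u =>
      cases h with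
      | cons hx h => exact ⟨.cons hx (ih u h).1, (ih u h).2⟩
      | cons_right h => exact ⟨.cons_right (ih (a :: u) h).1, (ih (a :: u) h).2⟩

theorem Ordinal.le_of_div_le_of_mod_le {a b c : Ordinal} (h : a / c ≤ b / c)
    (h' : a % c ≤ b % c) : a ≤ b := by
  rw [← Ordinal.div_add_mod a c, ← Ordinal.div_add_mod b c]
  gcongr

open Ordinal in
/-- The sequences with entries at most `k` have maximal order type at least `ω ^ ω ^ k`. -/
theorem exists_reflecting (k : ℕ) : ∃ w : Ordinal.{0} → List ℕ,
    (∀ α < ω ^ (ω ^ (k : Ordinal.{0})), ∀ x ∈ w α, x ≤ k) ∧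
    ∀ α < ω ^ (ω ^ (k : Ordinal.{0})), ∀ β < ω ^ (ω ^ (k : Ordinal.{0})),
      EmbLE (w α) (w β) → α ≤ β := by
  induction k with
  | zero =>
    have h : ∀ α < ω, ∃ n : ℕ, α = n := fun α hα => lt_omega0.1 hα
    choose! n hn using h
    refine ⟨fun α => List.replicate (n α) 0, ?_, ?_⟩
    · intro α _ x hx
      exact (List.eq_of_mem_replicate hx).le
    · simp only [Nat.cast_zero, opow_zero, opow_one]
      intro α hα β hβ h
      rw [hn α hα, hn β hβ]
      simpa using h.length_le
  | succ k ih =>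
    obtain ⟨w, hw, hr⟩ := ih
    set Ω := ω ^ (ω ^ (k : Ordinal.{0}))
    have hΩ0 : Ω ≠ 0 := (opow_pos _ omega0_pos).ne'
    -- Ordinals below `Ω ^ (j + 1)` are written with `j + 1` digits in base `Ω`, each coded by `w`,
    -- with the new letter `k + 1` as separator.
    have key (j : ℕ) : ∃ v : Ordinal.{0} → List ℕ,
        (∀ α < Ω ^ (j + 1), ∀ x ∈ v α, x ≤ k + 1) ∧
        (∀ α < Ω ^ (j + 1), ((v α).filter (k + 1 ≤ ·)).length = j) ∧
        ∀ α < Ω ^ (j + 1), ∀ β < Ω ^ (j + 1), EmbLE (v α) (v β) → α ≤ β := by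
      induction j with
      | zero =>
        simp only [zero_add, pow_one]
        refine ⟨w, fun α hα x hx => (hw α hα x hx).trans k.le_succ, fun α hα => ?_, hr⟩
        rw [List.length_eq_zero_iff, List.filter_eq_nil_iff]
        intro x hx
        simpa using hw α hα x hx
      | succ j ihj =>
        obtain ⟨v, hv, hc, hvr⟩ := ihj
        have h0 : Ω ^ (j + 1) ≠ 0 := pow_ne_zero _ hΩ0
        have hmod (α : Ordinal.{0}) : α % Ω ^ (j + 1) < Ω ^ (j + 1) := mod_lt _ h0
        have hdiv {α : Ordinal.{0}} (h : α < Ω ^ (j + 1 + 1)) : α / Ω ^ (j + 1) < Ω := by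
          rw [← lt_mul_iff_div_lt h0, ← pow_succ]
          exact h
        refine ⟨fun α => w (α / Ω ^ (j + 1)) ++ (k + 1) :: v (α % Ω ^ (j + 1)), ?_, ?_, ?_⟩
        · intro α hα x hx
          rcases List.mem_append.1 hx with h | h
          · exact (hw _ (hdiv hα) x h).trans k.le_succ
          · rcases List.mem_cons.1 h with rfl | h
            · exact le_rfl
            · exact hv _ (hmod α) x h
        · intro α hα
          have h : (w (α / Ω ^ (j + 1))).filter (k + 1 ≤ ·) = [] := by
            rw [List.filter_eq_nil_iff]
            intro x hx
            simpa using hw _ (hdiv hα) x hx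
          rw [List.filter_append, h, List.nil_append, List.filter_cons_of_pos (by simp),
            List.length_cons, hc _ (hmod α)]
        · intro α hα β hβ h
          have h := h.split (fun x hx => Nat.lt_succ_of_le (hw _ (hdiv hβ) x hx))
            ((hc _ (hmod α)).trans (hc _ (hmod β)).symm)
          exact le_of_div_le_of_mod_le (hr _ (hdiv hα) _ (hdiv hβ) h.1)
            (hvr _ (hmod α) _ (hmod β) h.2)
    choose v hv hc hvr using key
    have hex : ∀ α < ω ^ (ω ^ ((k + 1 : ℕ) : Ordinal.{0})), ∃ j : ℕ, α < Ω ^ (j + 1) := by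
      intro α hα
      rw [Nat.cast_succ, opow_add, opow_one, opow_mul,
        lt_opow_of_isSuccLimit hΩ0 isSuccLimit_omega0] at hα
      obtain ⟨c, hc, h⟩ := hα
      obtain ⟨n, rfl⟩ := lt_omega0.1 hc
      refine ⟨n, h.trans_le ?_⟩
      rw [opow_natCast]
      exact pow_le_pow_right₀ (Order.one_le_iff_ne_zero.2 hΩ0) n.le_succ
    -- The least admissible `j` makes the number of separators monotone in `α`, so words with
    -- different numbers of them are also compared correctly.
    let J (α : Ordinal.{0}) : ℕ := sInf {j | α < Ω ^ (j + 1)}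
    have hJ : ∀ α < ω ^ (ω ^ ((k + 1 : ℕ) : Ordinal.{0})), α < Ω ^ (J α + 1) :=
      fun α hα => Nat.sInf_mem (hex α hα)
    refine ⟨fun α => v (J α) α, fun α hα => hv _ _ (hJ α hα), fun α hα β hβ h => ?_⟩
    have hle : J α ≤ J β := by
      rw [← hc _ _ (hJ α hα), ← hc _ _ (hJ β hβ)]
      exact h.length_filter_le
    rcases hle.eq_or_lt with he | hlt
    · have hα' := hJ α hα
      simp only [he] at h hα'
      exact hvr _ _ hα' _ (hJ β hβ) h
    · by_contra hβα
      exact Nat.notMem_of_lt_sInf hlt ((not_le.1 hβα).trans (hJ α hα))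

/-! ### Binary words and gap orders -/

theorem HigmanLE.embLE {s t : List ℕ} (h : HigmanLE s t) : EmbLE s t := by
  obtain ⟨f, hf, hle⟩ := h
  rw [EmbLE, List.sublistForall₂_iff]
  refine ⟨List.ofFn fun i => t.get (f i), ?_, ?_⟩
  · rw [List.forall₂_iff_get]
    refine ⟨by simp, fun i h₁ h₂ => ?_⟩
    simpa using hle ⟨i, h₁⟩
  · rw [List.sublist_iff_exists_fin_orderEmbedding_get_eq]
    refine ⟨(Fin.castOrderIso (by simp)).toOrderEmbedding.trans (OrderEmbedding.ofStrictMono f hf),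
      fun i => ?_⟩
    simp
    rfl

/-- The strong gap order: entries before the image of the first position are constrained too. -/
inductive StrongGapLE {α : Type*} [LE α] : List α → List α → Prop
  | nil {t} : StrongGapLE [] t
  | cons {a b s t} : a ≤ b → StrongGapLE s t → StrongGapLE (a :: s) (b :: t)
  | skip {a b s t} : a ≤ b → StrongGapLE (a :: s) t → StrongGapLE (a :: s) (b :: t)

theorem WeakGapLE.cons_right {α : Type*} [LinearOrder α] [WellFoundedLT α] {s t : List α}
    (h : WeakGapLE s t) (b : α) : WeakGapLE s (b :: t) := by
  obtain ⟨f, hf, hle, hgap⟩ := h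
  refine ⟨fun i => (f i).succ, fun i j h => Fin.succ_lt_succ_iff.2 (hf h), hle, ?_⟩
  intro i hi j h₁ h₂
  cases j using Fin.cases with
  | zero => exact absurd h₁ (Fin.not_lt_zero _)
  | succ j => exact hgap i hi j (Fin.succ_lt_succ_iff.1 h₁) (Fin.succ_lt_succ_iff.1 h₂)

theorem WeakGapLE.append_left {α : Type*} [LinearOrder α] [WellFoundedLT α] {s t : List α}
    (h : WeakGapLE s t) (p : List α) : WeakGapLE s (p ++ t) := by
  induction p with
  | nil => exact h
  | cons b p ih => exact ih.cons_right b

theorem StrongGapLE.exists_strictMono {α : Type*} [LE α] {s t : List α} (h : StrongGapLE s t) :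
    ∃ f : Fin s.length → Fin t.length, StrictMono f ∧ (∀ i, s.get i ≤ t.get (f i)) ∧
      (∀ (h0 : 0 < s.length) (j : Fin t.length), j < f ⟨0, h0⟩ → s.get ⟨0, h0⟩ ≤ t.get j) ∧
      ∀ (i : ℕ) (hi : i + 1 < s.length) (j : Fin t.length),
        f ⟨i, Nat.lt_of_succ_lt hi⟩ < j → j < f ⟨i + 1, hi⟩ → s.get ⟨i + 1, hi⟩ ≤ t.get j := by
  induction h with
  | nil => exact ⟨nofun, nofun, nofun, nofun, nofun⟩
  | @cons a b s t hab _ ih =>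
    obtain ⟨f, hf, hle, hgap₀, hgap⟩ := ih
    refine ⟨Fin.cons 0 fun i => (f i).succ, ?_, ?_, ?_, ?_⟩
    · intro i j h
      cases j using Fin.cases with
      | zero => exact absurd h (Fin.not_lt_zero _)
      | succ j =>
        cases i using Fin.cases with
        | zero => exact Fin.succ_pos _
        | succ i => exact Fin.succ_lt_succ_iff.2 (hf (Fin.succ_lt_succ_iff.1 h))
    · intro i
      cases i using Fin.cases with
      | zero => exact hab
      | succ i => exact hle i
    · intro h0 j h
      exact absurd h (Fin.not_lt_zero _)
    · intro i hi j h₁ h₂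
      cases j using Fin.cases with
      | zero => exact absurd h₁ (Fin.not_lt_zero _)
      | succ j =>
        cases i with
        | zero => exact hgap₀ (Nat.lt_of_succ_lt_succ hi) j (Fin.succ_lt_succ_iff.1 h₂)
        | succ i =>
          exact hgap i (Nat.lt_of_succ_lt_succ hi) j (Fin.succ_lt_succ_iff.1 h₁)
            (Fin.succ_lt_succ_iff.1 h₂)
  | @skip a b s t hab _ ih =>
    obtain ⟨f, hf, hle, hgap₀, hgap⟩ := ih
    refine ⟨fun i => (f i).succ, fun i j h => Fin.succ_lt_succ_iff.2 (hf h), hle, ?_, ?_⟩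
    · intro h0 j h
      cases j using Fin.cases with
      | zero => exact hab
      | succ j => exact hgap₀ h0 j (Fin.succ_lt_succ_iff.1 h)
    · intro i hi j h₁ h₂
      cases j using Fin.cases with
      | zero => exact absurd h₁ (Fin.not_lt_zero _)
      | succ j => exact hgap i hi j (Fin.succ_lt_succ_iff.1 h₁) (Fin.succ_lt_succ_iff.1 h₂)

theorem StrongGapLE.weakGapLE {α : Type*} [LinearOrder α] [WellFoundedLT α] {s t : List α}
    (h : StrongGapLE s t) : WeakGapLE s t :=
  let ⟨f, hf, hle, _, hgap⟩ := h.exists_strictMono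
  ⟨f, hf, hle, hgap⟩

/-- The word `0 1^b₀ 0 1^b₁ ⋯` for a sequence `b`. -/
def zeroBlocks : List ℕ → List (Fin 2)
  | [] => []
  | c :: b => 0 :: (List.replicate c 1 ++ zeroBlocks b)

/-- The word `1^b₀ 0 1^b₁ 0 1^b₂ ⋯` for a sequence `b`. -/
def blocks : List ℕ → List (Fin 2)
  | [] => []
  | c :: b => List.replicate c 1 ++ zeroBlocks b

theorem exists_blocks (t : List (Fin 2)) : ∃ c b, blocks (c :: b) = t := by
  induction t with
  | nil => exact ⟨0, [], rfl⟩
  | cons a t ih =>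
    obtain ⟨c, b, rfl⟩ := ih
    match a with
    | 0 => exact ⟨0, c :: b, rfl⟩
    | 1 => exact ⟨c + 1, b, rfl⟩

theorem StrongGapLE.zeroBlocks_append {b : List ℕ} {t : List (Fin 2)}
    (h : StrongGapLE (zeroBlocks b) t) (p : List (Fin 2)) :
    StrongGapLE (zeroBlocks b) (p ++ t) := by
  cases b with
  | nil => exact .nil
  | cons c b =>
    induction p with
    | nil => exact h
    | cons x p ih => exact .skip (Fin.zero_le x) ih

theorem StrongGapLE.block_append {b b' : ℕ} {bs : List ℕ} {t : List (Fin 2)} (hb : b ≤ b')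
    (h : StrongGapLE (zeroBlocks bs) t) :
    StrongGapLE (List.replicate b 1 ++ zeroBlocks bs) (List.replicate b' 1 ++ t) := by
  induction b generalizing b' with
  | zero => exact h.zeroBlocks_append _
  | succ b ih =>
    obtain ⟨b', rfl⟩ : ∃ c, b' = c + 1 := ⟨b' - 1, by omega⟩
    exact .cons le_rfl (ih (by omega))

/-- Ones of a block go to consecutive ones, and skipped letters only precede the image of a 0, where
the gap condition is vacuous. -/
theorem EmbLE.strongGapLE_zeroBlocks {b b' : List ℕ} (h : EmbLE b b') :
    StrongGapLE (zeroBlocks b) (zeroBlocks b') := by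
  induction h with
  | nil => exact .nil
  | cons hab _ ih => exact .cons le_rfl (ih.block_append hab)
  | cons_right _ ih => exact (ih.zeroBlocks_append _).zeroBlocks_append [0]

theorem EmbLE.weakGapLE_blocks {b b' : List ℕ} (h : EmbLE b b') : WeakGapLE (blocks b) (blocks b') := by
  induction b' with
  | nil =>
    cases h
    exact StrongGapLE.nil.weakGapLE
  | cons c' b' ih =>
    cases h with
    | nil => exact StrongGapLE.nil.weakGapLE
    | cons hab h => exact ((EmbLE.strongGapLE_zeroBlocks h).block_append hab).weakGapLE
    | cons_right h =>
      -- The first block has no leading 0, but the weak order does not constrain letters before the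
      -- first image.
      refine WeakGapLE.append_left ?_ _
      cases b' with
      | nil => exact ih h
      | cons d b' => exact (ih h).cons_right 0

theorem weakGapLE_blocks_of_length_le {y : List (Fin 2)} {c : ℕ} {b : List ℕ} (hc : c ∈ b)
    (hy : y.length ≤ c) : WeakGapLE y (blocks b) := by
  have ones (t : List (Fin 2)) : StrongGapLE y (List.replicate c 1 ++ t) := by
    clear hc
    induction y generalizing c with
    | nil => exact .nil
    | cons a y ih =>
      obtain ⟨c, rfl⟩ : ∃ d, c = d + 1 := ⟨c - 1, by simp at hy; omega⟩
      exact .cons (Fin.le_last a) (ih (by simpa using hy))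
  induction b with
  | nil => simp at hc
  | cons d b ih =>
    rcases List.mem_cons.1 hc with rfl | h
    · exact (ones _).weakGapLE
    · refine WeakGapLE.append_left ?_ _
      cases b with
      | nil => simp at h
      | cons e b => exact (ih h).cons_right 0

/-! ### The contradiction -/

open Ordinal in
theorem mainTheorem8 :
    ¬ ∃ f : List ℕ → List (Fin 2),
      IsQuasiEmbedding (HigmanLE (X := ℕ)) (WeakGapLE (α := Fin 2)) f := by
  rintro ⟨f, hf⟩
  let n := (f [0, 0]).length
  -- The bound `n + 2` exceeds both `n` and 1, the bounds occurring in `sh` below.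
  obtain ⟨w, hw, hr⟩ := exists_reflecting (n + 2)
  obtain ⟨c₀, b₀, hb₀⟩ := exists_blocks (f [n + 3])
  set N := (c₀ :: b₀).length with hN
  have hsmall : ∀ x ∈ c₀ :: b₀, x ≤ n := by
    intro x hx
    by_contra hlt
    have h := (hf [0, 0] [n + 3] (hb₀ ▸ weakGapLE_blocks_of_length_le hx (not_le.1 hlt).le))
    simpa using h.embLE.length_le
  choose c b hcb using fun α => exists_blocks (f (w α))
  have hfew : ∀ α < ω ^ (ω ^ ((n + 2 : ℕ) : Ordinal.{0})),
      ((c α :: b α).filter (n ≤ ·)).length < N := by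
    intro α hα
    by_contra hge
    have h := (EmbLE.of_length_le_filter hsmall (not_lt.1 hge)).weakGapLE_blocks
    rw [hb₀, hcb] at h
    obtain ⟨g, -, hg⟩ := hf _ _ h
    have := hg ⟨0, by simp⟩
    have := hw α hα _ (List.get_mem _ (g ⟨0, by simp⟩))
    simp_all
    omega
  choose us hl hs hglue using fun α => exists_glue n (c α :: b α)
  let sh (m : Fin N) : List ℕ := List.replicate (m + 1) n ++ List.replicate m 1
  have hwt (m : Fin N) : weight (sh m) < ω ^ ((n + 2 : ℕ) : Ordinal.{0}) := by
    apply hsum_lt_opow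
    intro x hx
    simp only [Multiset.mem_coe, List.mem_map, sh, List.mem_append, List.mem_replicate] at hx
    obtain ⟨y, hy, rfl⟩ := hx
    rw [Nat.cast_lt]
    omega
  have htot : hsum (∑ m, {weight (sh m)}) < ω ^ (ω ^ ((n + 2 : ℕ) : Ordinal.{0})) := by
    apply hsum_lt_opow
    intro x hx
    obtain ⟨m, -, hm⟩ := Multiset.mem_sum.1 hx
    exact Multiset.mem_singleton.1 hm ▸ hwt m
  let cs (α : Ordinal.{0}) : List ℕ := (c α :: b α).filter (n ≤ ·)
  have hpos : 0 < N := by simp [hN]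
  -- The lengths of long blocks are coded as sequences of zeros, that is, with bound 1. The default
  -- tag 0 is never used below `ω ^ ω ^ (n + 2)`.
  let g (α : Ordinal.{0}) : Fin N × List (List ℕ) :=
    (if h : (cs α).length < N then ⟨_, h⟩ else ⟨0, hpos⟩,
      us α ++ (cs α).map fun x => List.replicate x 0)
  have hg1 : ∀ α < ω ^ (ω ^ ((n + 2 : ℕ) : Ordinal.{0})), ((g α).1 : ℕ) = (cs α).length := by
    intro α hα
    simp only [g, dif_pos (show (cs α).length < N from hfew α hα)]
  refine not_reflecting _ (Fin N) sh rfl g ?_ ?_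
  · intro α hα
    replace hα := hα.trans_lt htot
    simp only [sh, hg1 α hα]
    refine List.rel_append (fills_replicate (hl α) (hs α)) (fills_replicate (by simp) ?_)
    simp +contextual [List.mem_replicate]
  · intro α hα β hβ htag hle
    replace hα := hα.trans_lt htot
    replace hβ := hβ.trans_lt htot
    have hlen : (cs α).length = (cs β).length := by rw [← hg1 α hα, ← hg1 β hβ, htag]
    have hlus : (us α).length = (us β).length := (hl α).trans (hlen ▸ (hl β).symm)
    have h₁ := List.forall₂_take (us α).length hle
    have h₂ := List.forall₂_drop (us α).length hle
    simp only [g] at h₁ h₂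
    rw [List.take_left, hlus, List.take_left] at h₁
    rw [List.drop_left, hlus, List.drop_left, List.forall₂_map_left_iff,
      List.forall₂_map_right_iff] at h₂
    have h := glue_mono (h₂.imp fun x y h => by simpa using h.length_le) h₁
    simp only [cs, hglue] at h
    have h := h.weakGapLE_blocks
    rw [hcb, hcb] at h
    exact hr α hα β hβ (hf _ _ h).embLE
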